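/- **Theorem (Power series roots with multiplicity over small characteristic).** An algebraic circuit over a field $\mathbb F$ is a directed acyclic graph whose input gates carry variables or elements of $\mathbb F$ and whose other gates are sums or products of unbounded fan-in; its size is its number of gates plus its number of wires, and its depth is the length of a longest path from an input gate to the output. For a power series $\psi$, $\operatorname{Hom}_{\le d}[\psi]$ denotes the sum of its homogeneous parts of degree at most $d$. There are an absolute constant $c\in\mathbb N$ and a function $k:\mathbb N\to\mathbb N$ such that the following holds. Let $\mathbb F$ be a field of characteristic $p>0$ and $\mathbf x=(x_1,\dots,x_n)$. Let $P(\mathbf x,y)\in\mathbb F[\mathbf x,y]$ be a polynomial computed by a circuit $C$ over $\mathbb F$, and suppose $$P(\mathbf x,y)=(y-\varphi(\mathbf x))^{p^\ell e}\cdot Q(\mathbf x,y)$$ with integers $\ell,e\ge 0$, $\gcd(p,e)=1$, and power series $\varphi\in\mathbb F[[\mathbf x]]$, $Q\in\mathbb F[[\mathbf x,y]]$ satisfying $\varphi(\mathbf 0)=0$ and $Q(\mathbf 0,0)\neq 0$. Let $d\in\mathbb N$, put $N=d+\operatorname{size}(C)+\deg P+2$, where $\deg P$ is the total degree, and assume that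 $\mathbb F$ is polynomially large: $\mathbb F$ is infinite or $|\mathbb F|\ge N^c$. Then there is a circuit $C'$ over $\mathbb F$ computing $\operatorname{Hom}_{\le d}[\varphi^{p^\ell}]$ with $$\operatorname{size}(C')\le N^c,\qquad \operatorname{depth}(C')\le\operatorname{depth}(C)+c,$$ and moreover $\operatorname{size}(C')\le (d+\operatorname{size}(C)+2)^{k(\operatorname{depth}(C))}$; so the size is polynomial in $d$, $\operatorname{size}(C)$ and $\deg P$, and for circuits of bounded depth it is polynomial in $d$ and $\operatorname{size}(C)$ alone. -/

import Mathlib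

/-- A gate of an algebraic circuit over the field `F` in the variables `V` that can read the gates
number `0, …, k - 1`: an input gate carrying a variable or a field constant, or a sum or product
gate of arbitrary fan-in. An argument may be repeated (parallel wires). -/
inductive AlgGate (F V : Type*) (k : ℕ) where
  | var (v : V) : AlgGate F V k
  | const (a : F) : AlgGate F V k
  | add (args : List (Fin k)) : AlgGate F V k
  | mul (args : List (Fin k)) : AlgGate F V k

/-- The number of incoming wires, counted with multiplicity. -/
def AlgGate.fanIn {F V : Type*} {k : ℕ} : AlgGate F V k → ℕ
  | .var _ => 0
  | .const _ => 0
  | .add args => args.length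
  | .mul args => args.length

/-- An algebraic circuit over `F` in the variables `V`: a directed acyclic graph of gates, listed
in topological order (gate number `i` reads only gates with smaller numbers), with one output. -/
structure AlgCircuit (F V : Type*) where
  numGates : ℕ
  gate : (i : Fin numGates) → AlgGate F V i
  out : Fin numGates

namespace AlgCircuit

variable {F V : Type*}

/-- The polynomial computed at gate `i`. -/
noncomputable def value [CommSemiring F] (C : AlgCircuit F V) (i : Fin C.numGates) :
    MvPolynomial V F :=
  match C.gate i with
  | .var v => MvPolynomial.X v
  | .const a => MvPolynomial.C a
  | .add args => (args.map fun j : Fin i => C.value ⟨j, j.isLt.trans i.isLt⟩).sum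
  | .mul args => (args.map fun j : Fin i => C.value ⟨j, j.isLt.trans i.isLt⟩).prod
termination_by i.val
decreasing_by all_goals exact j.isLt

/-- The number of wires on a longest directed path from an input gate to gate `i`. -/
def gateDepth (C : AlgCircuit F V) (i : Fin C.numGates) : ℕ :=
  match C.gate i with
  | .var _ => 0
  | .const _ => 0
  | .add args => (args.map fun j : Fin i => C.gateDepth ⟨j, j.isLt.trans i.isLt⟩).foldr max 0 + 1
  | .mul args => (args.map fun j : Fin i => C.gateDepth ⟨j, j.isLt.trans i.isLt⟩).foldr max 0 + 1
termination_by i.val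
decreasing_by all_goals exact j.isLt

/-- `C` computes `f`: the formal polynomial at the output gate is `f`. -/
def Computes [CommSemiring F] (C : AlgCircuit F V) (f : MvPolynomial V F) : Prop :=
  C.value C.out = f

/-- The size of a circuit: the number of its gates plus the number of its wires. -/
def size (C : AlgCircuit F V) : ℕ :=
  C.numGates + ∑ i, (C.gate i).fanIn

/-- The depth of a circuit: the length of a longest path from an input gate to the output. -/
def depth (C : AlgCircuit F V) : ℕ :=
  C.gateDepth C.out

end AlgCircuit

/-- A power series in `x₁, …, xₙ`, viewed as a power series in `x₁, …, xₙ, y`. The variable `xᵢ` is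
`some i` and the variable `y` is `none`. -/
noncomputable def inclXY {F : Type*} [CommSemiring F] {n : ℕ} (φ : MvPowerSeries (Fin n) F) :
    MvPowerSeries (Option (Fin n)) F :=
  MvPowerSeries.rename (some : Fin n → Option (Fin n)) φ

/-- The sum of the homogeneous parts of degree at most `d` of a power series. -/
noncomputable def homLE {F : Type*} [CommSemiring F] {n : ℕ} (d : ℕ)
    (φ : MvPowerSeries (Fin n) F) : MvPolynomial (Fin n) F :=
  MvPowerSeries.truncTotal (d + 1) φ

/-! Put q = p^ℓ, ψ = φ^q, U = y^q - ψ, m = qe and α = Q(0,0). Frobenius gives P = U^e Q, and a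
logarithmic derivative isolates ψ. The ordinary ∂/∂y kills U when q > 1, so it is replaced by
`divDeriv q`, which is linear over F[[x]] and obeys a Leibniz rule on the factor U. Thus divDeriv P
/ P = e y^q/U + divDeriv Q / Q. Expanding 1/U in powers of ψ/y^q, the coefficient of y^(-q) is eψ,
and the Q-part has no negative powers of y. Since p does not divide e, this determines ψ.

Division by P becomes a truncated geometric series around the leading form αy^m. With G = αy^m - P,
the sum S of (αy^m)^i G^(N-1-i) over i < N satisfies P S = (αy^m)^N - G^N. Give each x weight 2 and
y weight 1: then G has order greater than m (`weightedOrder_C_mul_X_pow_sub`), and for N = 2d+1 the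
G^N part is too heavy to reach a monomial x^a y^(mN-q) with |a| ≤ d. At these monomials the
polynomial divDeriv P · S has α^N e times the coefficients of ψ (`coeff_divDeriv_mul_geom_sum`).

This polynomial, `rootPoly`, has degree at most (2d+1) deg P. The required terms are therefore a
linear combination of its images under x ↦ sx, y ↦ a with s, a from a set of K nodes, and divDeriv P
is itself interpolated from such images of P (`cost_coeff_rootPoly`). Only constantly many layers
are added to the circuit. The bound free of deg P uses deg P ≤ size^depth. -/

namespace AlgCircuit

variable {F V : Type*}

/-! ### Unfolding values and depths of gates -/

section Values

variable [CommSemiring F] (C : AlgCircuit F V)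

theorem value_of_var {i : Fin C.numGates} {v : V} (h : C.gate i = .var v) :
    C.value i = MvPolynomial.X v := by
  rw [value, h]

theorem value_of_const {i : Fin C.numGates} {a : F} (h : C.gate i = .const a) :
    C.value i = MvPolynomial.C a := by
  rw [value, h]

theorem value_of_add {i : Fin C.numGates} {args : List (Fin i)} (h : C.gate i = .add args) :
    C.value i = (args.map fun j : Fin i => C.value ⟨j, j.isLt.trans i.isLt⟩).sum := by
  rw [value, h]

theorem value_of_mul {i : Fin C.numGates} {args : List (Fin i)} (h : C.gate i = .mul args) :
    C.value i = (args.map fun j : Fin i => C.value ⟨j, j.isLt.trans i.isLt⟩).prod := by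
  rw [value, h]

end Values

section Depths

variable (C : AlgCircuit F V)

theorem gateDepth_of_var {i : Fin C.numGates} {v : V} (h : C.gate i = .var v) :
    C.gateDepth i = 0 := by
  rw [gateDepth, h]

theorem gateDepth_of_const {i : Fin C.numGates} {a : F} (h : C.gate i = .const a) :
    C.gateDepth i = 0 := by
  rw [gateDepth, h]

theorem gateDepth_of_add {i : Fin C.numGates} {args : List (Fin i)} (h : C.gate i = .add args) :
    C.gateDepth i =
      (args.map fun j : Fin i => C.gateDepth ⟨j, j.isLt.trans i.isLt⟩).foldr max 0 + 1 := by
  rw [gateDepth, h]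

theorem gateDepth_of_mul {i : Fin C.numGates} {args : List (Fin i)} (h : C.gate i = .mul args) :
    C.gateDepth i =
      (args.map fun j : Fin i => C.gateDepth ⟨j, j.isLt.trans i.isLt⟩).foldr max 0 + 1 := by
  rw [gateDepth, h]

end Depths

theorem _root_.List.foldr_max_le {L : List ℕ} {b : ℕ} (h : ∀ a ∈ L, a ≤ b) :
    L.foldr max 0 ≤ b := by
  induction L with
  | nil => simp
  | cons a L ih =>
    simp only [List.foldr_cons, max_le_iff]
    exact ⟨h a (by simp), ih fun x hx => h x (by simp [hx])⟩

theorem _root_.List.le_foldr_max {L : List ℕ} {a : ℕ} (h : a ∈ L) : a ≤ L.foldr max 0 := by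
  induction L with
  | nil => simp at h
  | cons b L ih =>
    simp only [List.foldr_cons, le_max_iff]
    rcases List.mem_cons.1 h with rfl | h
    · exact Or.inl le_rfl
    · exact Or.inr (ih h)

/-- Append a gate to a circuit and make it the output. -/
def snoc (C : AlgCircuit F V) (g : AlgGate F V C.numGates) : AlgCircuit F V where
  numGates := C.numGates + 1
  gate i := Fin.lastCases (motive := fun i => AlgGate F V i) g (fun i => C.gate i) i
  out := Fin.last _

/-! ### Appending gates to a circuit -/

section Snoc

variable (C : AlgCircuit F V) (g : AlgGate F V C.numGates)

theorem snoc_gate_castSucc (i : Fin C.numGates) :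
    (C.snoc g).gate i.castSucc = C.gate i := by
  simp [snoc]

theorem snoc_gate_last : (C.snoc g).gate (Fin.last _) = g := by
  simp [snoc]

theorem size_snoc : (C.snoc g).size = C.size + 1 + g.fanIn := by
  have h : ∑ i, ((C.snoc g).gate i).fanIn = ∑ i, (C.gate i).fanIn + g.fanIn := by
    refine (Fin.sum_univ_castSucc (n := C.numGates)
      (fun i : Fin (C.numGates + 1) => ((C.snoc g).gate i).fanIn)).trans ?_
    rw [snoc_gate_last]
    congr 1
    exact Finset.sum_congr rfl fun i _ => by rw [snoc_gate_castSucc]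
  rw [size, size, h]
  simp only [snoc]
  omega

theorem value_snoc_castSucc [CommSemiring F] (i : Fin C.numGates) :
    (C.snoc g).value i.castSucc = C.value i := by
  obtain ⟨i, hi⟩ := i
  induction i using Nat.strong_induction_on with
  | _ i ih =>
  have hg := snoc_gate_castSucc C g ⟨i, hi⟩
  cases h : C.gate ⟨i, hi⟩ with
  | var v => rw [value_of_var _ (hg.trans h), value_of_var _ h]
  | const a => rw [value_of_const _ (hg.trans h), value_of_const _ h]
  | add args =>
    rw [value_of_add _ (hg.trans h), value_of_add _ h]
    congr 1
    exact List.map_congr_left fun j _ => ih j j.isLt (j.isLt.trans hi)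
  | mul args =>
    rw [value_of_mul _ (hg.trans h), value_of_mul _ h]
    congr 1
    exact List.map_congr_left fun j _ => ih j j.isLt (j.isLt.trans hi)

theorem gateDepth_snoc_castSucc (i : Fin C.numGates) :
    (C.snoc g).gateDepth i.castSucc = C.gateDepth i := by
  obtain ⟨i, hi⟩ := i
  induction i using Nat.strong_induction_on with
  | _ i ih =>
  have hg := snoc_gate_castSucc C g ⟨i, hi⟩
  cases h : C.gate ⟨i, hi⟩ with
  | var v => rw [gateDepth_of_var _ (hg.trans h), gateDepth_of_var _ h]
  | const a => rw [gateDepth_of_const _ (hg.trans h), gateDepth_of_const _ h]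
  | add args =>
    rw [gateDepth_of_add _ (hg.trans h), gateDepth_of_add _ h]
    congr 2
    exact List.map_congr_left fun j _ => ih j j.isLt (j.isLt.trans hi)
  | mul args =>
    rw [gateDepth_of_mul _ (hg.trans h), gateDepth_of_mul _ h]
    congr 2
    exact List.map_congr_left fun j _ => ih j j.isLt (j.isLt.trans hi)

end Snoc

theorem one_le_size (C : AlgCircuit F V) : 1 ≤ C.size := by
  have := C.out.isLt
  rw [size]
  omega

theorem fanIn_le_size (C : AlgCircuit F V) (i : Fin C.numGates) : (C.gate i).fanIn ≤ C.size :=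
  (Finset.single_le_sum (f := fun i => (C.gate i).fanIn) (fun _ _ => Nat.zero_le _)
    (Finset.mem_univ i)).trans (Nat.le_add_left _ _)

variable [CommSemiring F]

/-- Some gate of `C` of depth at most `δ` computes `f`. -/
def Provides (C : AlgCircuit F V) (f : MvPolynomial V F) (δ : ℕ) : Prop :=
  ∃ i, C.value i = f ∧ C.gateDepth i ≤ δ

/-- Everything provided by `C` is provided by `C'`. -/
def Extends (C' C : AlgCircuit F V) : Prop :=
  ∀ f δ, C.Provides f δ → C'.Provides f δ

theorem Extends.refl (C : AlgCircuit F V) : C.Extends C := fun _ _ h => h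

theorem Extends.trans {C₁ C₂ C₃ : AlgCircuit F V} (h : C₁.Extends C₂) (h' : C₂.Extends C₃) :
    C₁.Extends C₃ := fun f δ hf => h f δ (h' f δ hf)

theorem Provides.mono {C : AlgCircuit F V} {f : MvPolynomial V F} {δ δ' : ℕ}
    (h : C.Provides f δ) (hδ : δ ≤ δ') : C.Provides f δ' := by
  obtain ⟨i, hi, hd⟩ := h
  exact ⟨i, hi, hd.trans hδ⟩

theorem snoc_extends (C : AlgCircuit F V) (g : AlgGate F V C.numGates) :
    (C.snoc g).Extends C := by
  rintro f δ ⟨i, hi, hd⟩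
  exact ⟨i.castSucc, by rw [value_snoc_castSucc, hi], by rwa [gateDepth_snoc_castSucc]⟩

theorem exists_args {C : AlgCircuit F V} {δ : ℕ} {L : List (MvPolynomial V F)}
    (h : ∀ f ∈ L, C.Provides f δ) :
    ∃ args : List (Fin C.numGates), args.map C.value = L ∧ ∀ i ∈ args, C.gateDepth i ≤ δ := by
  induction L with
  | nil => exact ⟨[], by simp⟩
  | cons f L ih =>
    obtain ⟨args, h1, h2⟩ := ih fun f hf => h f (by simp [hf])
    obtain ⟨i, hi, hd⟩ := h f (by simp)
    refine ⟨i :: args, by simp [hi, h1], ?_⟩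
    simpa [hd] using h2

theorem exists_sum_gate {C : AlgCircuit F V} {δ : ℕ} {L : List (MvPolynomial V F)}
    (h : ∀ f ∈ L, C.Provides f δ) :
    ∃ C' : AlgCircuit F V, C'.Extends C ∧ C'.value C'.out = L.sum ∧ C'.gateDepth C'.out ≤ δ + 1 ∧
      C'.size = C.size + 1 + L.length := by
  obtain ⟨args, h1, h2⟩ := exists_args h
  have hg : (C.snoc (.add args)).gate (C.snoc (.add args)).out = .add args := snoc_gate_last _ _
  refine ⟨C.snoc (.add args), snoc_extends _ _, ?_, ?_, ?_⟩
  · rw [value_of_add _ hg, ← h1]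
    congr 1
    exact List.map_congr_left fun j _ => value_snoc_castSucc C _ j
  · rw [gateDepth_of_add _ hg]
    refine Nat.succ_le_succ (List.foldr_max_le fun a ha => ?_)
    obtain ⟨j, hj, rfl⟩ := List.mem_map.1 ha
    exact (gateDepth_snoc_castSucc C _ j).trans_le (h2 j hj)
  · rw [size_snoc, ← h1]
    simp [AlgGate.fanIn]

theorem exists_prod_gate {C : AlgCircuit F V} {δ : ℕ} {L : List (MvPolynomial V F)}
    (h : ∀ f ∈ L, C.Provides f δ) :
    ∃ C' : AlgCircuit F V, C'.Extends C ∧ C'.value C'.out = L.prod ∧ C'.gateDepth C'.out ≤ δ + 1 ∧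
      C'.size = C.size + 1 + L.length := by
  obtain ⟨args, h1, h2⟩ := exists_args h
  have hg : (C.snoc (.mul args)).gate (C.snoc (.mul args)).out = .mul args := snoc_gate_last _ _
  refine ⟨C.snoc (.mul args), snoc_extends _ _, ?_, ?_, ?_⟩
  · rw [value_of_mul _ hg, ← h1]
    congr 1
    exact List.map_congr_left fun j _ => value_snoc_castSucc C _ j
  · rw [gateDepth_of_mul _ hg]
    refine Nat.succ_le_succ (List.foldr_max_le fun a ha => ?_)
    obtain ⟨j, hj, rfl⟩ := List.mem_map.1 ha
    exact (gateDepth_snoc_castSucc C _ j).trans_le (h2 j hj)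
  · rw [size_snoc, ← h1]
    simp [AlgGate.fanIn]

/-- Every circuit can be extended by gates and wires of total number at most `s` so that it provides
`f` at depth at most `δ`. -/
def Cost (f : MvPolynomial V F) (δ s : ℕ) : Prop :=
  ∀ C : AlgCircuit F V, ∃ C' : AlgCircuit F V,
    C'.Extends C ∧ C'.Provides f δ ∧ C'.size ≤ C.size + s

/-! ### Calculus of incremental circuit cost -/

namespace Cost

variable {f g : MvPolynomial V F} {δ δ' s s' : ℕ}

theorem mono (h : Cost f δ s) (hδ : δ ≤ δ') (hs : s ≤ s') : Cost f δ' s' := fun C => by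
  obtain ⟨C', h1, h2, h3⟩ := h C
  exact ⟨C', h1, h2.mono hδ, by omega⟩

theorem const (a : F) : Cost (MvPolynomial.C a : MvPolynomial V F) 0 1 := fun C => by
  have hg : (C.snoc (.const a)).gate (Fin.last _) = .const a := snoc_gate_last _ _
  refine ⟨C.snoc (.const a), snoc_extends _ _, ⟨Fin.last _, value_of_const _ hg,
    (gateDepth_of_const _ hg).le⟩, ?_⟩
  rw [size_snoc]
  rfl

theorem X (v : V) : Cost (MvPolynomial.X v : MvPolynomial V F) 0 1 := fun C => by
  have hg : (C.snoc (.var v)).gate (Fin.last _) = .var v := snoc_gate_last _ _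
  refine ⟨C.snoc (.var v), snoc_extends _ _, ⟨Fin.last _, value_of_var _ hg,
    (gateDepth_of_var _ hg).le⟩, ?_⟩
  rw [size_snoc]
  rfl

/-- Because `Cost` quantifies over the starting circuit, the extensions can be chained and their
sizes simply add up. -/
theorem exists_forall {L : List (MvPolynomial V F)} (h : ∀ f ∈ L, Cost f δ s)
    (C : AlgCircuit F V) :
    ∃ C' : AlgCircuit F V, C'.Extends C ∧ (∀ f ∈ L, C'.Provides f δ) ∧
      C'.size ≤ C.size + L.length * s := by
  induction L with
  | nil => exact ⟨C, .refl C, by simp, by simp⟩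
  | cons f L ih =>
    obtain ⟨C₁, h1, h2, h3⟩ := ih fun f hf => h f (by simp [hf])
    obtain ⟨C₂, h1', h2', h3'⟩ := h f (by simp) C₁
    refine ⟨C₂, h1'.trans h1, ?_, ?_⟩
    · intro g hg
      rcases List.mem_cons.1 hg with rfl | hg
      · exact h2'
      · exact h1' _ _ (h2 g hg)
    · rw [List.length_cons, Nat.succ_mul]
      omega

theorem list_sum {L : List (MvPolynomial V F)} (h : ∀ f ∈ L, Cost f δ s) :
    Cost L.sum (δ + 1) (L.length * (s + 1) + 1) := fun C => by
  obtain ⟨C₁, h1, h2, h3⟩ := exists_forall h C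
  obtain ⟨C₂, h1', h2', h3', h4'⟩ := exists_sum_gate h2
  refine ⟨C₂, h1'.trans h1, ⟨_, h2', h3'⟩, ?_⟩
  rw [mul_add]
  omega

theorem list_prod {L : List (MvPolynomial V F)} (h : ∀ f ∈ L, Cost f δ s) :
    Cost L.prod (δ + 1) (L.length * (s + 1) + 1) := fun C => by
  obtain ⟨C₁, h1, h2, h3⟩ := exists_forall h C
  obtain ⟨C₂, h1', h2', h3', h4'⟩ := exists_prod_gate h2
  refine ⟨C₂, h1'.trans h1, ⟨_, h2', h3'⟩, ?_⟩
  rw [mul_add]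
  omega

theorem sum {ι : Type*} (t : Finset ι) {f : ι → MvPolynomial V F}
    (h : ∀ i ∈ t, Cost (f i) δ s) : Cost (∑ i ∈ t, f i) (δ + 1) (t.card * (s + 1) + 1) := by
  have := list_sum (L := t.toList.map f) (δ := δ) (s := s) (by
    intro g hg
    obtain ⟨i, hi, rfl⟩ := List.mem_map.1 hg
    exact h i (by simpa using hi))
  simpa using this

theorem pow (h : Cost f δ s) (k : ℕ) : Cost (f ^ k) (δ + 1) (k * (s + 1) + 1) := by
  have := list_prod (L := List.replicate k f) (δ := δ) (s := s) (by
    intro g hg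
    rwa [List.eq_of_mem_replicate hg])
  simpa using this

theorem add (hf : Cost f δ s) (hg : Cost g δ s) : Cost (f + g) (δ + 1) (2 * s + 3) := by
  have := list_sum (L := [f, g]) (δ := δ) (s := s) (by simp [hf, hg])
  refine (by simpa using this : Cost (f + g) _ _).mono le_rfl (by omega)

theorem mul (hf : Cost f δ s) (hg : Cost g δ s) : Cost (f * g) (δ + 1) (2 * s + 3) := by
  have := list_prod (L := [f, g]) (δ := δ) (s := s) (by simp [hf, hg])
  refine (by simpa using this : Cost (f * g) _ _).mono le_rfl (by omega)

theorem C_mul (a : F) (hf : Cost f δ s) (hs : 1 ≤ s) :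
    Cost (MvPolynomial.C a * f) (δ + 1) (2 * s + 3) :=
  mul ((const a).mono (Nat.zero_le _) hs) hf

/-- Substituting cheap polynomials for the variables of a circuit. -/
theorem aeval_value {W : Type*} (D : AlgCircuit F W) (σ : W → MvPolynomial V F)
    (hs : 1 ≤ s) (hσ : ∀ w, Cost (σ w) δ s) (i : Fin D.numGates) :
    Cost (MvPolynomial.aeval σ (D.value i)) (D.gateDepth i + δ) (s * D.size) := by
  intro C
  -- Invariant: the first t gates of D are simulated. Every gate is charged s plus its fan-in, which
  -- covers both an input gate (at most s) and a sum or product gate (1 plus fan-in, with 1 ≤ s).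
  have key : ∀ t : ℕ, t ≤ D.numGates → ∃ C' : AlgCircuit F V, C'.Extends C ∧
      (∀ i : Fin D.numGates, i.val < t →
        C'.Provides (MvPolynomial.aeval σ (D.value i)) (D.gateDepth i + δ)) ∧
      C'.size ≤ C.size + ∑ i ∈ Finset.univ.filter (fun i : Fin D.numGates => i.val < t),
        (s + (D.gate i).fanIn) := by
    intro t
    induction t with
    | zero => exact fun _ => ⟨C, .refl C, by simp, by simp⟩
    | succ t ih =>
      intro ht
      obtain ⟨C₁, h1, h2, h3⟩ := ih (by omega)
      have hsum : ∑ i ∈ Finset.univ.filter (fun i : Fin D.numGates => i.val < t + 1),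
            (s + (D.gate i).fanIn) =
          ∑ i ∈ Finset.univ.filter (fun i : Fin D.numGates => i.val < t),
            (s + (D.gate i).fanIn) + (s + (D.gate ⟨t, ht⟩).fanIn) := by
        rw [show Finset.univ.filter (fun i : Fin D.numGates => i.val < t + 1) =
          insert ⟨t, ht⟩ (Finset.univ.filter (fun i : Fin D.numGates => i.val < t)) from by
            ext j; simp [Fin.ext_iff]; omega, Finset.sum_insert (by simp), add_comm]
      suffices ∃ C₂ : AlgCircuit F V, C₂.Extends C₁ ∧
          C₂.Provides (MvPolynomial.aeval σ (D.value ⟨t, ht⟩)) (D.gateDepth ⟨t, ht⟩ + δ) ∧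
          C₂.size ≤ C₁.size + (s + (D.gate ⟨t, ht⟩).fanIn) by
        obtain ⟨C₂, h1', h2', h3'⟩ := this
        refine ⟨C₂, h1'.trans h1, fun i hi => ?_, by omega⟩
        rcases Nat.lt_succ_iff_lt_or_eq.1 hi with hi | hi
        · exact h1' _ _ (h2 i hi)
        · obtain rfl : i = ⟨t, ht⟩ := Fin.ext hi
          exact h2'
      cases h : D.gate ⟨t, ht⟩ with
      | var v =>
        rw [value_of_var _ h, gateDepth_of_var _ h, MvPolynomial.aeval_X]
        obtain ⟨C₂, h1', h2', h3'⟩ := hσ v C₁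
        exact ⟨C₂, h1', h2'.mono (by omega), by omega⟩
      | const a =>
        rw [value_of_const _ h, gateDepth_of_const _ h, MvPolynomial.aeval_C]
        obtain ⟨C₂, h1', h2', h3'⟩ := const (V := V) a C₁
        exact ⟨C₂, h1', h2'.mono (Nat.zero_le _), by omega⟩
      | add args =>
        rw [value_of_add _ h, gateDepth_of_add _ h, map_list_sum, List.map_map]
        obtain ⟨C₂, h1', h2', h3', h4'⟩ := exists_sum_gate (C := C₁)
          (δ := (args.map fun j : Fin t => D.gateDepth ⟨j, j.isLt.trans ht⟩).foldr max 0 + δ)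
          (L := args.map fun j : Fin t => MvPolynomial.aeval σ (D.value ⟨j, j.isLt.trans ht⟩))
          (by
            intro g hg
            obtain ⟨j, hj, rfl⟩ := List.mem_map.1 hg
            refine (h2 ⟨j, _⟩ j.isLt).mono (Nat.add_le_add_right (List.le_foldr_max ?_) _)
            exact List.mem_map.2 ⟨j, hj, rfl⟩)
        refine ⟨C₂, h1', ⟨_, h2', h3'.trans (by simp only []; omega)⟩, ?_⟩
        rw [h4', List.length_map, AlgGate.fanIn]
        omega
      | mul args =>
        rw [value_of_mul _ h, gateDepth_of_mul _ h, map_list_prod, List.map_map]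
        obtain ⟨C₂, h1', h2', h3', h4'⟩ := exists_prod_gate (C := C₁)
          (δ := (args.map fun j : Fin t => D.gateDepth ⟨j, j.isLt.trans ht⟩).foldr max 0 + δ)
          (L := args.map fun j : Fin t => MvPolynomial.aeval σ (D.value ⟨j, j.isLt.trans ht⟩))
          (by
            intro g hg
            obtain ⟨j, hj, rfl⟩ := List.mem_map.1 hg
            refine (h2 ⟨j, _⟩ j.isLt).mono (Nat.add_le_add_right (List.le_foldr_max ?_) _)
            exact List.mem_map.2 ⟨j, hj, rfl⟩)
        refine ⟨C₂, h1', ⟨_, h2', h3'.trans (by simp only []; omega)⟩, ?_⟩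
        rw [h4', List.length_map, AlgGate.fanIn]
        omega
  obtain ⟨C', h1, h2, h3⟩ := key D.numGates le_rfl
  refine ⟨C', h1, h2 i i.isLt, h3.trans (Nat.add_le_add_left ?_ _)⟩
  simp only [Fin.is_lt, Finset.filter_true, Finset.sum_add_distrib, Finset.sum_const,
    Finset.card_univ, Fintype.card_fin, smul_eq_mul, size]
  rw [mul_add, mul_comm]
  exact Nat.add_le_add_left (Nat.le_mul_of_pos_left _ hs) _

/-- The construction starts from a single constant gate, since a circuit cannot be empty. A unary
sum gate finally makes f the output; these account for the 3 in the size and the 1 in the depth. -/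
theorem exists_circuit (h : Cost f δ s) :
    ∃ C : AlgCircuit F V, C.Computes f ∧ C.size ≤ s + 3 ∧ C.depth ≤ δ + 1 := by
  obtain ⟨C₁, -, h2, h3⟩ := h ⟨1, fun _ => .const 0, 0⟩
  obtain ⟨C₂, -, h2', h3', h4'⟩ := exists_sum_gate (C := C₁) (L := [f]) (δ := δ) (by simpa using h2)
  refine ⟨C₂, by simpa [Computes] using h2', ?_, h3'⟩
  have : (⟨1, fun _ => .const 0, 0⟩ : AlgCircuit F V).size = 1 := by simp [size, AlgGate.fanIn]
  simp only [List.length_singleton] at h4'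
  omega

end Cost

/-! ### Degree of the computed polynomials -/

theorem _root_.MvPolynomial.totalDegree_list_sum_le {L : List (MvPolynomial V F)} {b : ℕ}
    (h : ∀ f ∈ L, f.totalDegree ≤ b) : L.sum.totalDegree ≤ b := by
  induction L with
  | nil => simp
  | cons f L ih =>
    rw [List.sum_cons]
    exact (MvPolynomial.totalDegree_add _ _).trans
      (max_le (h f (by simp)) (ih fun g hg => h g (by simp [hg])))

theorem _root_.MvPolynomial.totalDegree_list_prod_le {L : List (MvPolynomial V F)} {b : ℕ}
    (h : ∀ f ∈ L, f.totalDegree ≤ b) : L.prod.totalDegree ≤ L.length * b := by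
  induction L with
  | nil => simp
  | cons f L ih =>
    rw [List.prod_cons, List.length_cons, Nat.succ_mul, add_comm]
    exact (MvPolynomial.totalDegree_mul _ _).trans
      (add_le_add (h f (by simp)) (ih fun g hg => h g (by simp [hg])))

/-- A product gate multiplies the largest degree below it by at most its fan-in, hence by at most
the size; sum gates do not raise it. -/
theorem totalDegree_value_le (C : AlgCircuit F V) (i : Fin C.numGates) :
    (C.value i).totalDegree ≤ C.size ^ C.gateDepth i := by
  obtain ⟨i, hi⟩ := i
  induction i using Nat.strong_induction_on with
  | _ i ih =>
  have hargs : ∀ args : List (Fin i),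
      ∀ f ∈ args.map fun j : Fin i => C.value ⟨j, j.isLt.trans hi⟩, f.totalDegree ≤
        C.size ^ (args.map fun j : Fin i => C.gateDepth ⟨j, j.isLt.trans hi⟩).foldr max 0 := by
    intro args f hf
    obtain ⟨j, hj, rfl⟩ := List.mem_map.1 hf
    exact (ih j j.isLt _).trans (Nat.pow_le_pow_right C.one_le_size
      (List.le_foldr_max (List.mem_map.2 ⟨j, hj, rfl⟩)))
  cases h : C.gate ⟨i, hi⟩ with
  | var v =>
    rw [value_of_var _ h, gateDepth_of_var _ h, pow_zero, MvPolynomial.X]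
    exact (MvPolynomial.totalDegree_monomial_le _ _).trans (by simp)
  | const a => rw [value_of_const _ h]; simp
  | add args =>
    rw [value_of_add _ h, gateDepth_of_add _ h]
    exact (MvPolynomial.totalDegree_list_sum_le (hargs args)).trans
      (Nat.pow_le_pow_right C.one_le_size (Nat.le_succ _))
  | mul args =>
    rw [value_of_mul _ h, gateDepth_of_mul _ h, pow_succ']
    refine (MvPolynomial.totalDegree_list_prod_le (hargs args)).trans ?_
    rw [List.length_map]
    refine Nat.mul_le_mul_right _ ?_
    have := C.fanIn_le_size ⟨i, hi⟩
    rwa [h] at this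

end AlgCircuit

/-! ### Lower bounds for weighted orders -/

namespace MvPowerSeries

section WeightedOrder

variable {σ R : Type*} [CommRing R] {w : σ → ℕ} {f g : MvPowerSeries σ R} {a b : ℕ}

theorem le_weightedOrder_mul_of_le (hf : (a : ℕ∞) ≤ f.weightedOrder w)
    (hg : (b : ℕ∞) ≤ g.weightedOrder w) : ((a + b : ℕ) : ℕ∞) ≤ (f * g).weightedOrder w := by
  rw [Nat.cast_add]
  exact (add_le_add hf hg).trans (le_weightedOrder_mul w)

theorem le_weightedOrder_pow_of_le (hf : (a : ℕ∞) ≤ f.weightedOrder w) (k : ℕ) :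
    ((k * a : ℕ) : ℕ∞) ≤ (f ^ k).weightedOrder w := by
  refine le_trans ?_ (le_weightedOrder_pow w k)
  rw [Nat.cast_mul, nsmul_eq_mul]
  exact mul_le_mul_right hf _

theorem le_weightedOrder_add_of_le (hf : (a : ℕ∞) ≤ f.weightedOrder w)
    (hg : (a : ℕ∞) ≤ g.weightedOrder w) : (a : ℕ∞) ≤ (f + g).weightedOrder w :=
  (le_min hf hg).trans (min_weightedOrder_le_add w)

theorem le_weightedOrder_sub_of_le (hf : (a : ℕ∞) ≤ f.weightedOrder w)
    (hg : (a : ℕ∞) ≤ g.weightedOrder w) : (a : ℕ∞) ≤ (f - g).weightedOrder w := by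
  rw [sub_eq_add_neg]
  exact le_weightedOrder_add_of_le hf (by rwa [weightedOrder_neg])

theorem le_weightedOrder_sum_of_le {ι : Type*} (s : Finset ι) {f : ι → MvPowerSeries σ R}
    (h : ∀ i ∈ s, (a : ℕ∞) ≤ (f i).weightedOrder w) :
    (a : ℕ∞) ≤ (∑ i ∈ s, f i).weightedOrder w := by
  classical
  induction s using Finset.induction_on with
  | empty => simp
  | insert i s hi ih =>
    rw [Finset.sum_insert hi]
    exact le_weightedOrder_add_of_le (h i (by simp)) (ih fun j hj => h j (by simp [hj]))

theorem le_weightedOrder_X (s : σ) : ((w s : ℕ) : ℕ∞) ≤ (X s : MvPowerSeries σ R).weightedOrder w := by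
  classical
  refine nat_le_weightedOrder w fun d hd => ?_
  rw [coeff_X, if_neg]
  rintro rfl
  simp [Finsupp.weight_single] at hd

theorem one_le_weightedOrder (hw : ∀ s, w s ≠ 0) (hf : constantCoeff f = 0) :
    ((1 : ℕ) : ℕ∞) ≤ f.weightedOrder w := by
  refine nat_le_weightedOrder w fun d hd => ?_
  have : d = 0 := by
    ext s
    have h := Finsupp.le_weight w (hw s) d
    simpa using (h.trans_lt hd)
  rw [this, coeff_zero_eq_constantCoeff_apply, hf]

/-- Discards error terms by weight alone, with no information on the cofactor g. -/
theorem coeff_mul_eq_zero_of_le_weightedOrder {d : σ →₀ ℕ} (hf : (a : ℕ∞) ≤ f.weightedOrder w)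
    (hd : Finsupp.weight w d < a) (g : MvPowerSeries σ R) : coeff d (f * g) = 0 := by
  refine coeff_eq_zero_of_lt_weightedOrder w (lt_of_lt_of_le (Nat.cast_lt.2 hd) ?_)
  simpa using le_weightedOrder_mul_of_le hf (b := 0) (g := g) (by simp)

end WeightedOrder

/-! ### Series in x inside series in x and y, and the operator `divDeriv` -/

section Incl

variable {F : Type*} [CommRing F] {n : ℕ}

/-- The weight that is `a` on every `xᵢ` and `b` on `y`. -/
def wtXY (n a b : ℕ) : Option (Fin n) → ℕ := fun o => o.elim b fun _ => a

theorem weight_wtXY (a b : ℕ) (d : Option (Fin n) →₀ ℕ) :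
    Finsupp.weight (wtXY n a b) d = a * d.some.degree + b * d none := by
  rw [Finsupp.weight_apply, Finsupp.sum_option_index_smul, Finsupp.degree_eq_sum,
    Finsupp.sum_fintype _ _ (by simp), Finset.mul_sum]
  simp [wtXY, mul_comm, add_comm]

theorem coeff_inclXY (φ : MvPowerSeries (Fin n) F) (d : Option (Fin n) →₀ ℕ) :
    coeff d (inclXY φ) = if d none = 0 then coeff d.some φ else 0 := by
  split_ifs with h
  · have hd : d = Finsupp.embDomain Function.Embedding.some d.some := by
      ext o
      cases o with
      | none =>
        rw [h, Finsupp.embDomain_of_notMem_range]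
        simp
      | some i => exact (Finsupp.embDomain_apply_self Function.Embedding.some d.some i).symm
    conv_lhs => rw [hd]
    exact coeff_embDomain_rename Function.Embedding.some φ d.some
  · refine coeff_rename_eq_zero _ _ ?_
    rintro ⟨x, rfl⟩
    exact h (Finsupp.mapDomain_of_notMem_range _ _ (by simp))

theorem inclXY_pow (φ : MvPowerSeries (Fin n) F) (k : ℕ) : inclXY (φ ^ k) = inclXY φ ^ k :=
  map_pow _ _ _

theorem coeff_inclXY_mul_X_pow (φ : MvPowerSeries (Fin n) F) (j : ℕ) (d : Option (Fin n) →₀ ℕ) :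
    coeff d (inclXY φ * X none ^ j) = if d none = j then coeff d.some φ else 0 := by
  classical
  rw [X_pow_eq, coeff_mul_monomial, mul_one]
  split_ifs with h1 h2 h2
  · rw [coeff_inclXY, if_pos (by simp [h2])]
    congr 2
    ext i
    simp
  · rw [coeff_inclXY, if_neg]
    have := h1 none
    simp at this ⊢
    omega
  · exact absurd (Finsupp.single_le_iff.2 h2.ge) h1
  · rfl

theorem le_weightedOrder_inclXY {φ : MvPowerSeries (Fin n) F} (hφ : constantCoeff φ = 0)
    (a b : ℕ) : (a : ℕ∞) ≤ (inclXY φ).weightedOrder (wtXY n a b) := by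
  refine nat_le_weightedOrder _ fun d hd => ?_
  rw [weight_wtXY] at hd
  have h0 : d.some.degree = 0 := by
    by_contra h
    have := Nat.le_mul_of_pos_right a (Nat.pos_of_ne_zero h)
    omega
  rw [Finsupp.degree_eq_zero_iff] at h0
  rw [coeff_inclXY, h0, coeff_zero_eq_constantCoeff_apply, hφ, ite_self]

/-- The operator that multiplies the monomials `x ^ a * y ^ i` by `⌊i / q⌋`. In characteristic `p`
and for `q` a power of `p` it is `y ^ q` times the Hasse derivative of order `q` in `y`. -/
noncomputable def divDeriv (q : ℕ) (f : MvPowerSeries (Option (Fin n)) F) :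
    MvPowerSeries (Option (Fin n)) F :=
  fun d => ((d none / q : ℕ) : F) * coeff d f

theorem coeff_divDeriv (q : ℕ) (f : MvPowerSeries (Option (Fin n)) F)
    (d : Option (Fin n) →₀ ℕ) : coeff d (divDeriv q f) = ((d none / q : ℕ) : F) * coeff d f :=
  rfl

theorem divDeriv_sub (q : ℕ) (f g : MvPowerSeries (Option (Fin n)) F) :
    divDeriv q (f - g) = divDeriv q f - divDeriv q g := by
  ext d
  simp only [coeff_divDeriv, map_sub, mul_sub]

theorem divDeriv_inclXY_mul (q : ℕ) (φ : MvPowerSeries (Fin n) F)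
    (f : MvPowerSeries (Option (Fin n)) F) :
    divDeriv q (inclXY φ * f) = inclXY φ * divDeriv q f := by
  classical
  ext d
  rw [coeff_divDeriv, coeff_mul, coeff_mul, Finset.mul_sum]
  refine Finset.sum_congr rfl fun x hx => ?_
  rw [coeff_inclXY, coeff_divDeriv]
  split_ifs with h
  · rw [← Finset.HasAntidiagonal.mem_antidiagonal.1 hx, Finsupp.add_apply, h, zero_add]
    ring
  · simp

/-- Shifting the y-exponent by q raises its quotient by q by exactly one. This holds in every
characteristic. -/
theorem divDeriv_X_pow_mul {q : ℕ} (hq : 0 < q) (f : MvPowerSeries (Option (Fin n)) F) :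
    divDeriv q (X none ^ q * f) = X none ^ q * f + X none ^ q * divDeriv q f := by
  classical
  ext d
  rw [map_add, coeff_divDeriv, X_pow_eq, coeff_monomial_mul, coeff_monomial_mul]
  split_ifs with h
  · have hd : d none = (d none - q) + q := by
      have := Finsupp.single_le_iff.1 h
      omega
    rw [coeff_divDeriv, Finsupp.tsub_apply, Finsupp.single_eq_same]
    conv_lhs => rw [hd, Nat.add_div_right _ hq]
    push_cast
    ring
  · simp

/-- The logarithmic derivative of U^e Q with denominators cleared. The extra factor U on the left
avoids the exponent e - 1. -/
theorem divDeriv_pow_mul {q : ℕ} (hq : 0 < q) (φ : MvPowerSeries (Fin n) F) (e : ℕ)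
    (Q : MvPowerSeries (Option (Fin n)) F) :
    divDeriv q ((X none ^ q - inclXY φ) ^ e * Q) * (X none ^ q - inclXY φ) =
      (X none ^ q - inclXY φ) ^ e *
        ((e : MvPowerSeries (Option (Fin n)) F) * X none ^ q * Q + (X none ^ q - inclXY φ) * divDeriv q Q) := by
  induction e with
  | zero => simp; ring
  | succ e ih =>
    rw [pow_succ', mul_assoc, sub_mul, divDeriv_sub, divDeriv_X_pow_mul hq, divDeriv_inclXY_mul]
    push_cast
    linear_combination (X none ^ q - inclXY φ) * ih

end Incl

/-! ### Reading off the power of the root -/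

section Root

variable {F : Type*} [Field F] {n q e : ℕ}
  {φ : MvPowerSeries (Fin n) F} {P Q : MvPowerSeries (Option (Fin n)) F}

/-- Since φ^q has weight at least 2q, more than the weight q of y^q, the lowest form of P is
αy^(qe). -/
theorem weightedOrder_C_mul_X_pow_sub (hq : 0 < q) (he : 0 < e) (hφ : constantCoeff φ = 0)
    (hP : P = (X none ^ q - inclXY (φ ^ q)) ^ e * Q) :
    ((q * e + 1 : ℕ) : ℕ∞) ≤
      (C (constantCoeff Q) * X none ^ (q * e) - P).weightedOrder (wtXY n 2 1) := by
  set w := wtXY n 2 1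
  have hX : ((1 : ℕ) : ℕ∞) ≤ (X none : MvPowerSeries (Option (Fin n)) F).weightedOrder w :=
    le_weightedOrder_X none
  have hXq : ((q : ℕ) : ℕ∞) ≤ (X none ^ q : MvPowerSeries (Option (Fin n)) F).weightedOrder w := by
    simpa using le_weightedOrder_pow_of_le hX q
  have hψ : ((q * 2 : ℕ) : ℕ∞) ≤ (inclXY (φ ^ q)).weightedOrder w := by
    rw [inclXY_pow]
    exact le_weightedOrder_pow_of_le (le_weightedOrder_inclXY hφ 2 1) q
  have hψ' : ((q : ℕ) : ℕ∞) ≤ (inclXY (φ ^ q)).weightedOrder w :=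
    le_trans (Nat.cast_le.2 (by omega)) hψ
  have hQ : ((1 : ℕ) : ℕ∞) ≤ (Q - C (constantCoeff Q)).weightedOrder w := by
    refine one_le_weightedOrder (fun o => ?_) (by simp)
    cases o <;> simp [w, wtXY]
  have hgeom := (Commute.all (X none ^ q) (X none ^ q - inclXY (φ ^ q))).geom_sum₂_mul e
  rw [sub_sub_cancel] at hgeom
  have hS : ((q * (e - 1) : ℕ) : ℕ∞) ≤ (∑ i ∈ Finset.range e, (X none ^ q) ^ i *
      (X none ^ q - inclXY (φ ^ q)) ^ (e - 1 - i)).weightedOrder w := by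
    refine le_weightedOrder_sum_of_le _ fun i hi => ?_
    have := le_weightedOrder_mul_of_le (le_weightedOrder_pow_of_le hXq i)
      (le_weightedOrder_pow_of_le (le_weightedOrder_sub_of_le hXq hψ') (e - 1 - i))
    rwa [← add_mul, Nat.add_sub_cancel' (by have := Finset.mem_range.1 hi; omega), mul_comm] at this
  -- The first part is (y^(qe) - U^e) Q, which gains weight q from the factor ψ; the second gains 1
  -- because Q - α has no constant term.
  have hE : C (constantCoeff Q) * X none ^ (q * e) - P =
      (∑ i ∈ Finset.range e, (X none ^ q) ^ i *
        (X none ^ q - inclXY (φ ^ q)) ^ (e - 1 - i)) * inclXY (φ ^ q) * Q -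
      (X none ^ q) ^ e * (Q - C (constantCoeff Q)) := by
    rw [hgeom, hP, pow_mul]
    ring
  rw [hE]
  refine le_weightedOrder_sub_of_le ?_ ?_
  · have := le_weightedOrder_mul_of_le (le_weightedOrder_mul_of_le hS hψ) (b := 0) (g := Q)
      (by simp)
    refine le_trans (Nat.cast_le.2 ?_) this
    obtain ⟨e, rfl⟩ : ∃ e', e = e' + 1 := ⟨e - 1, by omega⟩
    simp only [Nat.add_sub_cancel, mul_add]
    omega
  · have := le_weightedOrder_mul_of_le (le_weightedOrder_pow_of_le hXq e) hQ
    rwa [mul_comm e q] at this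

/-- The coefficients of a power of a root can be read off from a polynomial expression in `P`. -/
theorem coeff_divDeriv_mul_geom_sum (hq : 0 < q) (he : 0 < e) (hφ : constantCoeff φ = 0)
    (hQ : constantCoeff Q ≠ 0) (hP : P = (X none ^ q - inclXY (φ ^ q)) ^ e * Q) (D : ℕ)
    {d : Option (Fin n) →₀ ℕ} (hd : d.some.degree ≤ D)
    (hd' : d none = q * e * (2 * D + 1) - q) :
    coeff d (divDeriv q P * ∑ i ∈ Finset.range (2 * D + 1),
        (C (constantCoeff Q) * X none ^ (q * e)) ^ i *
          (C (constantCoeff Q) * X none ^ (q * e) - P) ^ (2 * D + 1 - 1 - i)) =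
      constantCoeff Q ^ (2 * D + 1) * e * coeff d.some (φ ^ q) := by
  classical
  set α := constantCoeff Q
  set N := 2 * D + 1 with hN
  set G := C α * X none ^ (q * e) - P with hG
  have hGw : ((q * e + 1 : ℕ) : ℕ∞) ≤ G.weightedOrder (wtXY n 2 1) :=
    weightedOrder_C_mul_X_pow_sub hq he hφ hP
  have hgeom := (Commute.all (C α * X none ^ (q * e)) G).geom_sum₂_mul N
  rw [hG, sub_sub_cancel, ← hG] at hgeom
  set S := ∑ i ∈ Finset.range N, (C α * X none ^ (q * e)) ^ i * G ^ (N - 1 - i)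
  set ψ := inclXY (φ ^ q) with hψ
  set U := X none ^ q - ψ with hU
  set V := divDeriv q Q * Q⁻¹
  have hQV : Q * V = divDeriv q Q := by
    rw [mul_left_comm, MvPowerSeries.mul_inv_cancel _ hQ, mul_one]
  -- The logarithmic derivative of P, multiplied by P S = (αy^m)^N - G^N and by U.
  have hTU : divDeriv q P * S * U =
      ((e : MvPowerSeries (Option (Fin n)) F) * X none ^ q + U * V) * ((C α * X none ^ (q * e)) ^ N - G ^ N) := by
    have h1 := divDeriv_pow_mul hq (φ ^ q) e Q
    rw [← hψ, ← hU, ← hP] at h1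
    rw [← hgeom]
    linear_combination S * h1 - S * U * U ^ e * hQV - S * ((e : MvPowerSeries (Option (Fin n)) F) * X none ^ q + U * V) * hP
  -- Multiplying by y^(qL) replaces the expansion of 1/U in negative powers of y, as U Γ = y^(qL) -
  -- ψ^L. With L = D + 2, ψ^L lies beyond x-degree D, and the term of Γ linear in ψ has index L - 2
  -- = D.
  set L := D + 2 with hL
  have hgeom' := (Commute.all (X none ^ q) ψ).geom_sum₂_mul L
  rw [← hU] at hgeom'
  set Γ := ∑ i ∈ Finset.range L, (X none ^ q) ^ i * ψ ^ (L - 1 - i) with hΓ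
  -- Only the first summand reaches the monomial d'. The second has too large a y-exponent, the
  -- third too large an x-degree, and the last two too large a weight.
  have hmain : divDeriv q P * S * X none ^ (q * L) =
      C α ^ N * (e : MvPowerSeries (Option (Fin n)) F) * (Γ * X none ^ (q + q * e * N)) +
      X none ^ (q * L + q * e * N) * (C α ^ N * V) +
      ψ ^ L * (divDeriv q P * S - V * (C α * X none ^ (q * e)) ^ N) -
      (X none ^ q * Γ) * G ^ N * (e : MvPowerSeries (Option (Fin n)) F) - ((X none ^ q) ^ L - ψ ^ L) * G ^ N * V := by
    have h2 : divDeriv q P * S * ((X none ^ q) ^ L - ψ ^ L) =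
        ((e : MvPowerSeries (Option (Fin n)) F) * X none ^ q * Γ + ((X none ^ q) ^ L - ψ ^ L) * V) *
          ((C α * X none ^ (q * e)) ^ N - G ^ N) := by
      rw [← hgeom']
      linear_combination Γ * hTU
    rw [mul_pow (C α), ← pow_mul (X none) (q * e)] at h2 ⊢
    rw [← pow_mul (X none) q] at h2 ⊢
    rw [pow_add, pow_add]
    linear_combination h2
  -- The subtraction in the y-exponent of d is therefore not truncated.
  have hle : q ≤ q * e * N := by
    rw [mul_assoc]
    exact Nat.le_mul_of_pos_right _ (Nat.mul_pos he (by omega))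
  have hX (w) : ((w none : ℕ) : ℕ∞) ≤
      (X none : MvPowerSeries (Option (Fin n)) F).weightedOrder w := le_weightedOrder_X none
  have hψw (a b : ℕ) : ((q * a : ℕ) : ℕ∞) ≤ ψ.weightedOrder (wtXY n a b) := by
    rw [hψ, inclXY_pow]
    exact le_weightedOrder_pow_of_le (le_weightedOrder_inclXY hφ a b) q
  have hXq : ((q : ℕ) : ℕ∞) ≤
      (X none ^ q : MvPowerSeries (Option (Fin n)) F).weightedOrder (wtXY n 2 1) := by
    simpa [wtXY] using le_weightedOrder_pow_of_le (hX (wtXY n 2 1)) q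
  have hψ' : ((q : ℕ) : ℕ∞) ≤ ψ.weightedOrder (wtXY n 2 1) :=
    le_trans (Nat.cast_le.2 (by omega)) (hψw 2 1)
  have hΓw : ((L * q : ℕ) : ℕ∞) ≤ (X none ^ q * Γ).weightedOrder (wtXY n 2 1) := by
    rw [hΓ, Finset.mul_sum]
    refine le_weightedOrder_sum_of_le _ fun i hi => ?_
    have := le_weightedOrder_mul_of_le hXq (le_weightedOrder_mul_of_le
      (le_weightedOrder_pow_of_le hXq i) (le_weightedOrder_pow_of_le hψ' (L - 1 - i)))
    rwa [← add_mul, add_comm q, ← Nat.succ_mul, show (i + (L - 1 - i)).succ = L by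
      have := Finset.mem_range.1 hi; omega] at this
  have hBw : ((L * q : ℕ) : ℕ∞) ≤ ((X none ^ q) ^ L - ψ ^ L).weightedOrder (wtXY n 2 1) :=
    le_weightedOrder_sub_of_le (le_weightedOrder_pow_of_le hXq L)
      (le_weightedOrder_pow_of_le hψ' L)
  set d' := d + Finsupp.single none (q * L) with hdd
  have hsome : d'.some = d.some := by
    rw [hdd, Finsupp.some_add, Finsupp.some_single_none, add_zero]
  have hnone : d' none = q * e * N - q + q * L := by simp [hdd, hd']
  -- This fixes N = 2D + 1: the excess weight N of G^N must beat the weight of the x-part, which is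
  -- at most 2D.
  have hwt : Finsupp.weight (wtXY n 2 1) d' < L * q + N * (q * e + 1) := by
    rw [weight_wtXY, hsome, hnone, mul_comm L q, mul_comm N, add_mul]
    omega
  have hz1 : coeff d' ((X none ^ q * Γ) * G ^ N * (e : MvPowerSeries (Option (Fin n)) F)) = 0 :=
    coeff_mul_eq_zero_of_le_weightedOrder
      (le_weightedOrder_mul_of_le hΓw (le_weightedOrder_pow_of_le hGw N)) hwt _
  have hz2 : coeff d' (((X none ^ q) ^ L - ψ ^ L) * G ^ N * V) = 0 :=
    coeff_mul_eq_zero_of_le_weightedOrder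
      (le_weightedOrder_mul_of_le hBw (le_weightedOrder_pow_of_le hGw N)) hwt _
  have hz3 : coeff d' (ψ ^ L * (divDeriv q P * S - V * (C α * X none ^ (q * e)) ^ N)) = 0 := by
    refine coeff_mul_eq_zero_of_le_weightedOrder (le_weightedOrder_pow_of_le (hψw 1 0) L) ?_ _
    rw [weight_wtXY, hsome]
    have : L ≤ L * (q * 1) := Nat.le_mul_of_pos_right _ (by omega)
    omega
  have hz4 : coeff d' (X none ^ (q * L + q * e * N) * (C α ^ N * V)) = 0 := by
    refine coeff_mul_eq_zero_of_le_weightedOrder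
      (le_weightedOrder_pow_of_le (hX (wtXY n 0 1)) _) ?_ _
    rw [weight_wtXY, hnone]
    simp only [wtXY, Option.elim]
    omega
  have hqL : q * L = q * D + q * 2 := mul_add _ _ _
  have hone : coeff d' (Γ * X none ^ (q + q * e * N)) = coeff d.some (φ ^ q) := by
    rw [hΓ, Finset.sum_mul, map_sum, Finset.sum_eq_single D]
    · rw [show L - 1 - D = 1 by omega, pow_one, mul_right_comm, ← pow_mul, ← pow_add, mul_comm, hψ,
        coeff_inclXY_mul_X_pow, if_pos, hsome]
      rw [hnone]
      omega
    · intro i hi hiD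
      rw [mul_right_comm, ← pow_mul, ← pow_add, mul_comm, hψ, ← inclXY_pow,
        coeff_inclXY_mul_X_pow, if_neg]
      rw [hnone]
      intro h
      have : q * i = q * D := by omega
      exact hiD (Nat.eq_of_mul_eq_mul_left hq this)
    · intro h
      exact absurd (Finset.mem_range.2 (by omega)) h
  have hco := congrArg (coeff d') hmain
  rw [map_sub, map_sub, map_add, map_add, hz1, hz2, hz3, hz4, X_pow_eq, hdd,
    coeff_add_mul_monomial, ← hdd, mul_one] at hco
  rw [hco, sub_zero, sub_zero, add_zero, add_zero, ← map_pow,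
    ← map_natCast (C : F →+* MvPowerSeries (Option (Fin n)) F) e, mul_assoc, coeff_C_mul,
    coeff_C_mul, hone, mul_assoc]

end Root

end MvPowerSeries

/-- Any functional on the coefficients of polynomials of degree less than `K` is a linear
combination of evaluations at `K` distinct points. -/
theorem exists_sum_mul_pow_eq {F : Type*} [Field F] {K : ℕ} {b : Fin K → F}
    (hb : Function.Injective b) (r : ℕ → F) :
    ∃ c : Fin K → F, ∀ i < K, ∑ u, c u * b u ^ i = r i := by
  have hdet : IsUnit (Matrix.vandermonde b).det :=
    (Matrix.det_vandermonde_ne_zero_iff.2 hb).isUnit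
  refine ⟨Matrix.vecMul (fun i : Fin K => r i) (Matrix.vandermonde b)⁻¹, fun i hi => ?_⟩
  have h : Matrix.vecMul (Matrix.vecMul (fun i : Fin K => r i) (Matrix.vandermonde b)⁻¹)
      (Matrix.vandermonde b) = fun i : Fin K => r i := by
    rw [Matrix.vecMul_vecMul, Matrix.nonsing_inv_mul _ hdet, Matrix.vecMul_one]
  exact congrFun h ⟨i, hi⟩

/-! ### Substitutions as term-by-term scalings -/

namespace MvPolynomial

variable {F : Type*} [Field F] {n : ℕ}

/-- The substitution `xᵢ ↦ s * xᵢ`, `y ↦ a`. -/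
noncomputable def subXY (s a : F) : Option (Fin n) → MvPolynomial (Fin n) F :=
  fun o => o.elim (C a) fun i => C s * X i

/-- The polynomial whose terms are those of `f` scaled by `g`, with `y` set to `1`. -/
noncomputable def scaleTerms (f : MvPolynomial (Option (Fin n)) F)
    (g : (Option (Fin n) →₀ ℕ) → F) : MvPolynomial (Fin n) F :=
  ∑ d ∈ f.support, monomial d.some (coeff d f * g d)

theorem aeval_subXY_monomial (s a c : F) (d : Option (Fin n) →₀ ℕ) :
    aeval (subXY s a) (monomial d c) = monomial d.some (c * (s ^ d.some.degree * a ^ d none)) := by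
  rw [aeval_monomial, Finsupp.prod_option_index _ _ (by simp) (by intros; rw [pow_add]),
    algebraMap_eq, monomial_eq (s := d.some)]
  simp only [subXY, Option.elim, mul_pow, Finsupp.prod_mul, Finsupp.degree_apply, map_mul, map_pow]
  rw [← Finset.prod_pow_eq_pow_sum, ← Finsupp.prod]
  ring

theorem aeval_subXY (s a : F) (f : MvPolynomial (Option (Fin n)) F) :
    aeval (subXY s a) f = scaleTerms f fun d => s ^ d.some.degree * a ^ d none := by
  conv_lhs => rw [f.as_sum, map_sum]
  exact Finset.sum_congr rfl fun d _ => aeval_subXY_monomial s a _ d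

/-- Reduces interpolation of polynomials to scalar identities, one for each exponent in the support.
-/
theorem sum_C_mul_scaleTerms {ι : Type*} (t : Finset ι) (c : ι → F)
    (f : MvPolynomial (Option (Fin n)) F) (g : ι → (Option (Fin n) →₀ ℕ) → F) :
    ∑ i ∈ t, C (c i) * scaleTerms f (g i) = scaleTerms f fun d => ∑ i ∈ t, c i * g i d := by
  simp only [scaleTerms, Finset.mul_sum, C_mul_monomial, map_sum]
  rw [Finset.sum_comm]
  refine Finset.sum_congr rfl fun d _ => Finset.sum_congr rfl fun i _ => ?_
  rw [mul_left_comm]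

theorem scaleTerms_congr {f : MvPolynomial (Option (Fin n)) F}
    {g g' : (Option (Fin n) →₀ ℕ) → F} (h : ∀ d ∈ f.support, g d = g' d) :
    scaleTerms f g = scaleTerms f g' :=
  Finset.sum_congr rfl fun d hd => by rw [h d hd]

/-- Setting y to 1 merges no surviving terms, because their y-exponent is fixed to r. -/
theorem coeff_scaleTerms_ite (f : MvPolynomial (Option (Fin n)) F) (D r : ℕ) (a : Fin n →₀ ℕ) :
    coeff a (scaleTerms f fun d =>
        (if d.some.degree ≤ D then 1 else 0) * if d none = r then 1 else 0) =
      if a.degree ≤ D then coeff (a.optionElim r) f else 0 := by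
  classical
  rw [scaleTerms, coeff_sum, Finset.sum_eq_single (a.optionElim r)]
  · rw [coeff_monomial, if_pos (by simp), Finsupp.some_optionElim, Finsupp.optionElim_apply_none]
    simp
  · intro d _ hd
    rw [coeff_monomial]
    split_ifs with h1 h2 h3
    · refine absurd ?_ hd
      rw [← h1, ← h3, Finsupp.optionElim_some]
    all_goals simp
  · intro h
    rw [notMem_support_iff.1 h]
    simp

/-- `MvPowerSeries.divDeriv` on polynomials. -/
noncomputable def divDeriv (q : ℕ) (f : MvPolynomial (Option (Fin n)) F) :
    MvPolynomial (Option (Fin n)) F :=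
  ∑ d ∈ f.support, monomial d (((d none / q : ℕ) : F) * coeff d f)

theorem coe_divDeriv (q : ℕ) (f : MvPolynomial (Option (Fin n)) F) :
    (divDeriv q f : MvPowerSeries (Option (Fin n)) F) = MvPowerSeries.divDeriv q f := by
  classical
  ext d
  rw [coeff_coe, MvPowerSeries.coeff_divDeriv, coeff_coe, divDeriv, coeff_sum]
  simp only [coeff_monomial, Finset.sum_ite_eq', mem_support_iff, ite_not]
  split_ifs with h
  · rw [h, mul_zero]
  · rfl

theorem totalDegree_divDeriv_le (q : ℕ) (f : MvPolynomial (Option (Fin n)) F) :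
    (divDeriv q f).totalDegree ≤ f.totalDegree :=
  totalDegree_finsetSum_le fun _ hd => (totalDegree_monomial_le _ _).trans
    (le_totalDegree (p := f) hd)

theorem le_totalDegree_of_mem_support {f : MvPolynomial (Option (Fin n)) F}
    {d : Option (Fin n) →₀ ℕ} (hd : d ∈ f.support) : d.some.degree + d none ≤ f.totalDegree := by
  refine le_trans (le_of_eq ?_) (le_totalDegree hd)
  rw [Finsupp.sum_option_index _ _ (by simp) (by simp), Finsupp.degree_apply, Finsupp.sum, add_comm]

theorem aeval_subXY_divDeriv (q : ℕ) (f : MvPolynomial (Option (Fin n)) F) (s a : F) :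
    aeval (subXY s a) (divDeriv q f) =
      scaleTerms f fun d => s ^ d.some.degree * (((d none / q : ℕ) : F) * a ^ d none) := by
  rw [divDeriv, map_sum]
  refine Finset.sum_congr rfl fun d _ => ?_
  rw [aeval_subXY_monomial]
  congr 1
  ring

end MvPolynomial

/-! ### Circuit for the coefficients by interpolation -/

namespace AlgCircuit

open MvPolynomial

variable {F : Type*} [Field F] {n : ℕ}

theorem Cost.subXY (s a : F) (o : Option (Fin n)) : Cost (subXY s a o) 1 5 := by
  cases o with
  | none => exact (Cost.const a).mono (by omega) (by omega)
  | some i => exact (Cost.X i).C_mul s le_rfl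

/-- The polynomial that encodes the powers of a root. -/
noncomputable def rootPoly (P : MvPolynomial (Option (Fin n)) F) (α : F) (q m M : ℕ) :
    MvPolynomial (Option (Fin n)) F :=
  MvPolynomial.divDeriv q P *
    ∑ i ∈ Finset.range (M + 1), (C α * X none ^ m) ^ i * (C α * X none ^ m - P) ^ (M - i)

/-- Each summand is a product of M + 1 factors of degree at most deg P, thanks to m ≤ deg P. This
determines how many nodes are needed. -/
theorem totalDegree_rootPoly_le (P : MvPolynomial (Option (Fin n)) F) (α : F) {q m : ℕ} (M : ℕ)
    (hm : m ≤ P.totalDegree) : (rootPoly P α q m M).totalDegree ≤ P.totalDegree * (M + 1) := by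
  have h1 : (C α * X none ^ m : MvPolynomial (Option (Fin n)) F).totalDegree ≤ P.totalDegree := by
    refine (totalDegree_mul _ _).trans ?_
    simpa [totalDegree_C, totalDegree_X_pow] using hm
  have h2 : (C α * X none ^ m - P).totalDegree ≤ P.totalDegree :=
    (totalDegree_sub _ _).trans (max_le h1 le_rfl)
  rw [rootPoly, show P.totalDegree * (M + 1) = P.totalDegree + P.totalDegree * M by ring]
  refine (totalDegree_mul _ _).trans (add_le_add (totalDegree_divDeriv_le q P) ?_)
  refine totalDegree_finsetSum_le fun i hi => ?_
  refine (totalDegree_mul _ _).trans ((add_le_add (totalDegree_pow _ _)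
    (totalDegree_pow _ _)).trans ?_)
  have hi' : i + (M - i) = M := by
    have := Finset.mem_range.1 hi
    omega
  calc _ ≤ i * P.totalDegree + (M - i) * P.totalDegree :=
        add_le_add (Nat.mul_le_mul_left _ h1) (Nat.mul_le_mul_left _ h2)
    _ = _ := by rw [← add_mul, hi', mul_comm]

/-- Extracting the terms `x ^ a * y ^ r` with `|a| ≤ D` from `rootPoly` with a circuit. -/
theorem cost_coeff_rootPoly (D : AlgCircuit F (Option (Fin n)))
    {P : MvPolynomial (Option (Fin n)) F} (hP : D.Computes P) (α κ : F) {q m : ℕ} (d r : ℕ)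
    (hm : m ≤ P.totalDegree) {K : ℕ} (hK : P.totalDegree * (2 * d + 1) < K) {b : Fin K → F}
    (hb : Function.Injective b) {s : ℕ} (hs1 : K * (10 * D.size + 4) + 1 ≤ s)
    (hs2 : (2 * d + 1) * (4 * d * (20 * D.size + 10) + 6) + 1 ≤ s) :
    Cost (C κ * scaleTerms (rootPoly P α q m (2 * d)) fun x =>
        (if x.some.degree ≤ d then 1 else 0) * if x none = r then 1 else 0)
      (D.depth + 9) (K * K * (4 * s + 10) + 1) := by
  -- The weights c₁ truncate the x-degree at d, c₂ select y^r, and c₃ v evaluate `divDeriv` at y = b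
  -- v from the values of P alone.
  obtain ⟨c₁, hc₁⟩ := exists_sum_mul_pow_eq hb fun i => if i ≤ d then 1 else 0
  obtain ⟨c₂, hc₂⟩ := exists_sum_mul_pow_eq hb fun i => if i = r then 1 else 0
  choose c₃ hc₃ using fun v : Fin K =>
    exists_sum_mul_pow_eq hb fun i => ((i / q : ℕ) : F) * b v ^ i
  have hdeg : ∀ x ∈ P.support, x none < K := fun x hx => by
    have := le_totalDegree_of_mem_support hx
    have := Nat.le_mul_of_pos_right P.totalDegree (show 0 < 2 * d + 1 by omega)
    omega
  have hderiv (u v : Fin K) : aeval (MvPolynomial.subXY (b u) (b v)) (MvPolynomial.divDeriv q P) =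
      ∑ w, C (c₃ v w) * aeval (MvPolynomial.subXY (b u) (b w)) P := by
    rw [aeval_subXY_divDeriv]
    simp only [aeval_subXY, sum_C_mul_scaleTerms]
    refine scaleTerms_congr fun x hx => ?_
    rw [← hc₃ v _ (hdeg x hx), Finset.mul_sum]
    exact Finset.sum_congr rfl fun w _ => by ring
  have hdeg' : ∀ x ∈ (rootPoly P α q m (2 * d)).support, x.some.degree < K ∧ x none < K :=
    fun x hx => by
      have := le_totalDegree_of_mem_support hx
      have := totalDegree_rootPoly_le P α (q := q) (2 * d) hm
      omega
  have hextract : (C κ * scaleTerms (rootPoly P α q m (2 * d)) fun x =>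
        (if x.some.degree ≤ d then 1 else 0) * if x none = r then 1 else 0) =
      ∑ uv : Fin K × Fin K, C (κ * (c₁ uv.1 * c₂ uv.2)) *
        aeval (MvPolynomial.subXY (b uv.1) (b uv.2)) (rootPoly P α q m (2 * d)) := by
    simp only [C_mul (a := κ), mul_assoc (C κ)]
    rw [← Finset.mul_sum]
    simp only [aeval_subXY]
    rw [sum_C_mul_scaleTerms]
    congr 1
    refine scaleTerms_congr fun x hx => ?_
    rw [← hc₁ _ (hdeg' x hx).1, ← hc₂ _ (hdeg' x hx).2, Finset.sum_mul_sum,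
      ← Finset.sum_product', Finset.univ_product_univ]
    exact Finset.sum_congr rfl fun w _ => by ring
  rw [hextract]
  have hsz := D.one_le_size
  have hsub (u v : Fin K) :
      Cost (aeval (MvPolynomial.subXY (b u) (b v)) P) (D.depth + 1) (5 * D.size) := by
    have := Cost.aeval_value D (MvPolynomial.subXY (b u) (b v)) (s := 5) (by omega)
      (Cost.subXY (b u) (b v)) D.out
    rwa [show D.value D.out = P from hP] at this
  refine (Cost.sum Finset.univ (δ := D.depth + 8) (s := 4 * s + 9) fun uv _ => ?_).mono le_rfl
    (by simp)
  refine (Cost.C_mul _ (δ := D.depth + 7) (s := 2 * s + 3) ?_ (by omega)).mono le_rfl (by omega)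
  rw [rootPoly, map_mul, hderiv, map_sum]
  refine Cost.mul (δ := D.depth + 6) (s := s) ?_ ?_
  · refine (Cost.sum Finset.univ (δ := D.depth + 2) (s := 10 * D.size + 3) fun w _ => ?_).mono
      (by omega) (by simpa using hs1)
    exact ((hsub _ _).C_mul _ (by omega)).mono le_rfl (by omega)
  · refine (Cost.sum _ (δ := D.depth + 5) (s := 4 * d * (20 * D.size + 10) + 5)
      fun i hi => ?_).mono le_rfl (by simpa using hs2)
    -- As y becomes a scalar, (αy^m)^i is a single constant gate whatever the size of m.
    have hG : aeval (MvPolynomial.subXY (b uv.1) (b uv.2))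
        ((C α * X none ^ m) ^ i * (C α * X none ^ m - P) ^ (2 * d - i)) =
        C ((α * b uv.2 ^ m) ^ i) * (C (α * b uv.2 ^ m) +
          C (-1) * aeval (MvPolynomial.subXY (b uv.1) (b uv.2)) P) ^ (2 * d - i) := by
      simp only [map_mul, map_pow, map_sub, aeval_C, aeval_X, MvPolynomial.subXY, Option.elim,
        algebraMap_eq, map_neg, map_one]
      ring
    rw [hG]
    have h1 := (Cost.add (δ := D.depth + 2) (s := 10 * D.size + 3)
      ((Cost.const (V := Fin n) (α * b uv.2 ^ m)).mono (by omega) (by omega))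
      (((hsub uv.1 uv.2).C_mul (-1) (by omega)).mono le_rfl (by omega))).pow (2 * d - i)
    refine ((h1.mono le_rfl (?_ : _ ≤ 2 * d * (20 * D.size + 10) + 1)).C_mul _
      (by omega)).mono le_rfl ?_
    · refine Nat.succ_le_succ (Nat.mul_le_mul (Nat.sub_le _ _) ?_)
      omega
    · have : 4 * d * (20 * D.size + 10) = 2 * (2 * d * (20 * D.size + 10)) := by ring
      omega

end AlgCircuit

/-- A field with at least `K` elements contains `K` distinct elements. -/
theorem exists_injective_of_le_card {α : Type*} {K : ℕ} (h : (K : ℕ∞) ≤ ENat.card α) :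
    ∃ b : Fin K → α, Function.Injective b := by
  cases finite_or_infinite α with
  | inl _ =>
    have := Fintype.ofFinite α
    rw [ENat.card_eq_coe_fintype_card, Nat.cast_le] at h
    obtain ⟨f⟩ := Function.Embedding.nonempty_of_card_le (α := Fin K) (by simpa using h)
    exact ⟨f, f.injective⟩
  | inr _ => exact ⟨fun i => Infinite.natEmbedding α i, fun i j hij =>
      Fin.ext ((Infinite.natEmbedding α).injective hij)⟩

open MvPolynomial in
theorem homLE_eq_scaleTerms_rootPoly {F : Type*} [Field F] {n q e : ℕ}
    {P : MvPolynomial (Option (Fin n)) F} {φ : MvPowerSeries (Fin n) F}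
    {Q : MvPowerSeries (Option (Fin n)) F} (hq : 0 < q) (he : (e : F) ≠ 0)
    (hφ : MvPowerSeries.constantCoeff φ = 0) (hQ : MvPowerSeries.constantCoeff Q ≠ 0)
    (hP : (P : MvPowerSeries (Option (Fin n)) F) =
      (MvPowerSeries.X none ^ q - inclXY (φ ^ q)) ^ e * Q) (d : ℕ) :
    homLE d (φ ^ q) = C (MvPowerSeries.constantCoeff Q ^ (2 * d + 1) * e)⁻¹ *
      scaleTerms (AlgCircuit.rootPoly P (MvPowerSeries.constantCoeff Q) q (q * e) (2 * d)) fun x =>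
        (if x.some.degree ≤ d then 1 else 0) *
          if x none = q * e * (2 * d + 1) - q then 1 else 0 := by
  have he' : 0 < e := Nat.pos_of_ne_zero (by rintro rfl; simp at he)
  ext a
  rw [coeff_C_mul, coeff_scaleTerms_ite, homLE, MvPowerSeries.coeff_truncTotal_eq_ite]
  simp only [Nat.lt_succ_iff]
  split_ifs with h
  · have key := MvPowerSeries.coeff_divDeriv_mul_geom_sum hq he' hφ hQ hP d
      (d := a.optionElim (q * e * (2 * d + 1) - q)) (by simpa using h) (by simp)
    have hco : (AlgCircuit.rootPoly P (MvPowerSeries.constantCoeff Q) q (q * e) (2 * d) :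
        MvPowerSeries (Option (Fin n)) F) = MvPowerSeries.divDeriv q P *
          ∑ i ∈ Finset.range (2 * d + 1),
          (MvPowerSeries.C (MvPowerSeries.constantCoeff Q) * MvPowerSeries.X none ^ (q * e)) ^ i *
          (MvPowerSeries.C (MvPowerSeries.constantCoeff Q) * MvPowerSeries.X none ^ (q * e) -
            (P : MvPowerSeries (Option (Fin n)) F)) ^
            (2 * d + 1 - 1 - i) := by
      rw [AlgCircuit.rootPoly, coe_mul, coe_divDeriv]
      congr 1
      rw [← coeToMvPowerSeries.ringHom_apply, map_sum]
      refine Finset.sum_congr rfl fun i _ => ?_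
      simp only [map_mul, map_pow, map_sub, coeToMvPowerSeries.ringHom_apply, coe_C, coe_X,
        Nat.add_sub_cancel]
    rw [← coeff_coe, hco, key, Finsupp.some_optionElim, inv_mul_cancel_left₀]
    exact mul_ne_zero (pow_ne_zero _ hQ) he
  · rw [mul_zero]

/-- The leading form αy^(qe) forces the coefficient of y^(qe) in P to be α, which is nonzero. -/
theorem le_totalDegree_of_root {F : Type*} [Field F] {n q e : ℕ}
    {P : MvPolynomial (Option (Fin n)) F} {φ : MvPowerSeries (Fin n) F}
    {Q : MvPowerSeries (Option (Fin n)) F} (hq : 0 < q) (he : 0 < e)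
    (hφ : MvPowerSeries.constantCoeff φ = 0) (hQ : MvPowerSeries.constantCoeff Q ≠ 0)
    (hP : (P : MvPowerSeries (Option (Fin n)) F) =
      (MvPowerSeries.X none ^ q - inclXY (φ ^ q)) ^ e * Q) :
    q * e ≤ P.totalDegree := by
  classical
  have h0 := MvPowerSeries.coeff_eq_zero_of_lt_weightedOrder (MvPowerSeries.wtXY n 2 1)
    (d := Finsupp.single none (q * e)) (lt_of_lt_of_le (Nat.cast_lt.2 (by
      rw [MvPowerSeries.weight_wtXY, Finsupp.some_single_none, Finsupp.single_eq_same]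
      simp)) (MvPowerSeries.weightedOrder_C_mul_X_pow_sub hq he hφ hP))
  rw [map_sub, MvPowerSeries.coeff_C_mul, MvPowerSeries.coeff_X_pow, if_pos rfl, mul_one,
    MvPolynomial.coeff_coe, sub_eq_zero] at h0
  have := MvPolynomial.le_totalDegree_of_mem_support (f := P)
    (MvPolynomial.mem_support_iff.2 (h0 ▸ hQ))
  rwa [Finsupp.some_single_none, Finsupp.single_eq_same, map_zero, zero_add] at this

/-- Here g is deg P, g(2d+1)+1 is the number K of nodes, and the final 3 comes from
`exists_circuit`. With base N ≥ 3, which absorbs constants, K² ≤ N^8 and the other factor is at most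
N^13; the remaining 4 costs one more power. -/
theorem size_bound_le_pow {d s g : ℕ} (hs : 1 ≤ s) :
    (g * (2 * d + 1) + 1) * (g * (2 * d + 1) + 1) *
        (4 * ((g * (2 * d + 1) + 1) * (10 * s + 4) + 1 +
          ((2 * d + 1) * (4 * d * (20 * s + 10) + 6) + 1)) + 10) + 1 + 3 ≤
      (d + s + g + 2) ^ 22 := by
  set N := d + s + g + 2 with hN
  have h3 : 3 ≤ N := by omega
  have hmul (a b i j k : ℕ) (h : a ≤ N ^ i) (h' : b ≤ N ^ j) (hk : i + j = k) :
      a * b ≤ N ^ k := by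
    rw [← hk, pow_add]
    exact Nat.mul_le_mul h h'
  have hsucc (i k : ℕ) (hk : i + 1 = k) : 3 * N ^ i ≤ N ^ k := by
    rw [← hk, pow_succ']
    exact Nat.mul_le_mul_right _ h3
  have h1 : N ^ 1 = N := pow_one N
  have e1 := hsucc 1 2 rfl
  have e2 := hsucc 2 3 rfl
  have e3 := hsucc 3 4 rfl
  have a1 : 2 * d + 1 ≤ N ^ 2 := by omega
  have a2 := hmul g (2 * d + 1) 1 2 3 (by omega) a1 rfl
  have a3 : g * (2 * d + 1) + 1 ≤ N ^ 4 := by omega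
  have a4 : 10 * s + 4 ≤ N ^ 4 := by omega
  have a5 : 20 * s + 10 ≤ N ^ 4 := by omega
  have a6 := hmul _ _ 4 4 8 a3 a4 rfl
  have a7 := hmul (4 * d) (20 * s + 10) 3 4 7 (by omega) a5 rfl
  have e7 := hsucc 7 8 rfl
  have p7 : 3 ≤ N ^ 7 := h3.trans (Nat.le_self_pow (by omega) N)
  have a8 : 4 * d * (20 * s + 10) + 6 ≤ N ^ 8 := by omega
  have a9 := hmul _ _ 2 8 10 a1 a8 rfl
  have e8 := hsucc 8 9 rfl
  have e9 := hsucc 9 10 rfl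
  have e10 := hsucc 10 11 rfl
  have e11 := hsucc 11 12 rfl
  have e12 := hsucc 12 13 rfl
  have a10 : 4 * ((g * (2 * d + 1) + 1) * (10 * s + 4) + 1 +
          ((2 * d + 1) * (4 * d * (20 * s + 10) + 6) + 1)) + 10 ≤ N ^ 13 := by
    omega
  have a11 := hmul _ _ 8 13 21 (hmul _ _ 4 4 8 a3 a3 rfl) a10 rfl
  have e21 := hsucc 21 22 rfl
  have p21 : 3 ≤ N ^ 21 := h3.trans (Nat.le_self_pow (by omega) N)
  omega

theorem mainTheorem8 :
    ∃ (c : ℕ) (k : ℕ → ℕ),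
      ∀ (F : Type*) [Field F] (p : ℕ) [CharP F p], p.Prime →
      ∀ (n : ℕ) (P : MvPolynomial (Option (Fin n)) F) (C : AlgCircuit F (Option (Fin n)))
        (φ : MvPowerSeries (Fin n) F) (Q : MvPowerSeries (Option (Fin n)) F) (l e : ℕ),
        C.Computes P →
        Nat.gcd p e = 1 →
        MvPowerSeries.constantCoeff φ = 0 →
        MvPowerSeries.constantCoeff Q ≠ 0 →
        (P : MvPowerSeries (Option (Fin n)) F)
          = (MvPowerSeries.X none - inclXY φ) ^ (p ^ l * e) * Q →
        ∀ d : ℕ,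
          (((d + C.size + P.totalDegree + 2) ^ c : ℕ) : ℕ∞) ≤ ENat.card F →
          ∃ C' : AlgCircuit F (Fin n),
            C'.Computes (homLE d (φ ^ p ^ l)) ∧
            C'.size ≤ (d + C.size + P.totalDegree + 2) ^ c ∧
            C'.size ≤ (d + C.size + 2) ^ k C.depth ∧
            C'.depth ≤ C.depth + c := by
  -- The factor δ + 2 comes from S + deg P ≤ S^(δ+2), where S = d + size + 2 and deg P ≤ S^δ.
  refine ⟨22, fun δ => (δ + 2) * 22, ?_⟩
  intro F _ p _ hp n P C φ Q l e hC hpe hφ hQ hP d hF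
  have hq : 0 < p ^ l := pow_pos hp.pos l
  -- Coprimality also excludes e = 0, as gcd(p, 0) = p.
  have he : (e : F) ≠ 0 := by
    rw [Ne, CharP.cast_eq_zero_iff F p, ← hp.coprime_iff_not_dvd]
    exact hpe
  have he' : 0 < e := Nat.pos_of_ne_zero (by rintro rfl; simp at he)
  have : Fact p.Prime := ⟨hp⟩
  have : CharP (MvPowerSeries (Option (Fin n)) F) p :=
    charP_of_injective_algebraMap (R := F) (MvPowerSeries.C_injective) p
  -- Frobenius turns (y - φ)^q into y^q - φ^q.
  rw [pow_mul, sub_pow_char_pow, ← MvPowerSeries.inclXY_pow] at hP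
  have hs := C.one_le_size
  have hbound := size_bound_le_pow (d := d) (g := P.totalDegree) hs
  set K := P.totalDegree * (2 * d + 1) + 1 with hK
  -- K is a factor of the size expression, so the same power that bounds the size supplies the
  -- nodes.
  have hKF : (K : ℕ∞) ≤ ENat.card F := by
    refine le_trans (Nat.cast_le.2 (le_trans ?_ hbound)) hF
    have h1 := Nat.le_mul_of_pos_right K (Nat.succ_pos _ : 0 < K)
    refine h1.trans ((Nat.le_mul_of_pos_right _ (by omega)).trans (Nat.le_add_right _ 4))
  obtain ⟨b, hb⟩ := exists_injective_of_le_card hKF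
  have hcost := AlgCircuit.cost_coeff_rootPoly C hC (MvPowerSeries.constantCoeff Q)
    (MvPowerSeries.constantCoeff Q ^ (2 * d + 1) * e)⁻¹ (q := p ^ l) d
    (p ^ l * e * (2 * d + 1) - p ^ l) (le_totalDegree_of_root hq he' hφ hQ hP)
    (Nat.lt_succ_self _) hb (Nat.le_add_right _ _) (Nat.le_add_left _ _)
  rw [← homLE_eq_scaleTerms_rootPoly hq he hφ hQ hP d] at hcost
  obtain ⟨C', h1, h2, h3⟩ := hcost.exists_circuit
  have hsize := h2.trans hbound
  refine ⟨C', h1, hsize, hsize.trans ?_, h3.trans (by omega)⟩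
  rw [pow_mul]
  refine Nat.pow_le_pow_left ?_ 22
  have hdeg : P.totalDegree ≤ (d + C.size + 2) ^ C.depth := by
    have := C.totalDegree_value_le C.out
    rw [show C.value C.out = P from hC] at this
    exact this.trans (Nat.pow_le_pow_left (by omega) _)
  set S := d + C.size + 2 with hS
  have hS3 : 3 ≤ S := by omega
  have h4 : S * 1 ≤ S * S ^ C.depth := Nat.mul_le_mul_left _ (Nat.one_le_pow _ _ (by omega))
  have h5 : S ^ C.depth * 1 ≤ S ^ C.depth * S := Nat.mul_le_mul_left _ (by omega)
  have h6 : S ^ C.depth * S * 3 ≤ S ^ C.depth * S * S := Nat.mul_le_mul_left _ hS3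
  rw [pow_add, pow_two, ← mul_assoc]
  rw [mul_comm S (S ^ _)] at h4
  omega
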